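/- Let $\mathcal N$ be a smooth (Hausdorff) manifold of dimension $m$. Let $\{\mathcal N,\gamma,\ell,\ell^{(2)}\}$ be metric hypersurface data, that is, $\gamma$ is a smooth symmetric two-covariant tensor field, $\ell$ a smooth one-form and $\ell^{(2)}$ a smooth function on $\mathcal N$ such that at every $p\in\mathcal N$ the symmetric bilinear form on $T_p\mathcal N\times\mathbb R$ $$\mathcal A|_p((W,a),(Z,b)) := \gamma|_p(W,Z)+a\,\ell|_p(Z)+b\,\ell|_p(W)+ab\,\ell^{(2)}|_p$$ is non-degenerate. (No signature is prescribed, and $\gamma$ may be degenerate at some or all points.) Let $\mathcal A^\sharp|_p$ be the contravariant tensor on $T_p\mathcal N\times\mathbb R$ defined by $\mathcal A^\sharp|_p(\cdot,\mathcal A|_p(V,\cdot))=V$ for all $V \in T_p\mathcal N\times\mathbb R$, and define the contravariant tensor $P$, the vector field $n$ and the function $n^{(2)}$ by $$\mathcal A^\sharp((\alpha,a),(\beta,b)) = P(\alpha,\beta)+a\,n(\beta)+b\,n(\alpha)+ab\,n^{(2)} ,\qquad \alpha,\beta\in T_p^*\mathcal N,\ a,b\in\mathbb R.$$ Put $$U:=\tfrac12\,\mathcal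 L_n\gamma+\tfrac12\big(\ell\otimes dn^{(2)}+dn^{(2)}\otimes\ell\big).$$ Then there exists a unique smooth torsion-free connection $\overset{\circ}{\nabla}$ on $T\mathcal N$ (the metric hypersurface connection) such that $$(\overset{\circ}{\nabla}_X\gamma)(Z,W)=-U(X,Z)\,\ell(W)-U(X,W)\,\ell(Z),$$ $$(\overset{\circ}{\nabla}_X\ell)(Z)+(\overset{\circ}{\nabla}_Z\ell)(X)=-2\,\ell^{(2)}\,U(X,Z)$$ for all smooth vector fields $X,Z,W$ on $\mathcal N$. Moreover, in every smooth local coordinate system $\{x^a\}$ of $\mathcal N$ its Christoffel symbols, defined by $\overset{\circ}{\nabla}_{\partial_b}\partial_a=\overset{\circ}{\Gamma}{}^c{}_{ab}\,\partial_c$, are $$\overset{\circ}{\Gamma}{}^{c}{}_{ab}=\tfrac12\,P^{cd}\left(\partial_a\gamma_{bd}+\partial_b\gamma_{ad}-\partial_d\gamma_{ab}\right)+\tfrac12\,n^c\left(\partial_a\ell_b+\partial_b\ell_a\right).$$ -/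

import Mathlib

open Bundle
open scoped Manifold ContDiff

noncomputable section

/-! ### Pointwise algebra -/

namespace HypersurfaceAlgebra

variable {V : Type*} [AddCommGroup V] [Module ℝ V] [TopologicalSpace V]
  [IsTopologicalAddGroup V] [ContinuousSMul ℝ V]

/-- The bilinear form `𝒜((W,a),(Z,b)) = γ(W,Z) + a ℓ(Z) + b ℓ(W) + a b ℓ₂` on `V × ℝ`. -/
def ambientForm (g : V →L[ℝ] V →L[ℝ] ℝ) (l : V →L[ℝ] ℝ) (l₂ : ℝ) :
    LinearMap.BilinForm ℝ (V × ℝ) :=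
  LinearMap.mk₂ ℝ
    (fun p q ↦ g p.1 q.1 + p.2 * l q.1 + q.2 * l p.1 + p.2 * q.2 * l₂)
    (fun p p' q ↦ by simp; ring)
    (fun c p q ↦ by simp; ring)
    (fun p q q' ↦ by simp; ring)
    (fun c p q ↦ by simp; ring)

/-- The contravariant form `B♯(α, β)` on the dual space associated with a nondegenerate
bilinear form `B`: it is determined by `B♯(α, B(v, ·)) = α(v)`. -/
def sharpForm {W : Type*} [AddCommGroup W] [Module ℝ W] [FiniteDimensional ℝ W]
    (B : LinearMap.BilinForm ℝ W) (hB : B.Nondegenerate)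
    (α β : Module.Dual ℝ W) : ℝ :=
  α ((B.toDual hB).symm β)

/-- The defining property of `B♯`. -/
lemma sharpForm_apply {W : Type*} [AddCommGroup W] [Module ℝ W] [FiniteDimensional ℝ W]
    (B : LinearMap.BilinForm ℝ W) (hB : B.Nondegenerate) (α : Module.Dual ℝ W) (v : W) :
    sharpForm B hB α (B v) = α v := by
  have h : B v = B.toDual hB v := by ext w; simp [LinearMap.BilinForm.toDual_def]
  rw [sharpForm, h, LinearEquiv.symm_apply_apply]

/-- The element `(α, a)` of `V* × ℝ`, seen as an element of the dual of `V × ℝ`. -/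
def dualPair (α : Module.Dual ℝ V) (a : ℝ) : Module.Dual ℝ (V × ℝ) :=
  α ∘ₗ LinearMap.fst ℝ V ℝ + a • LinearMap.snd ℝ V ℝ

end HypersurfaceAlgebra

open HypersurfaceAlgebra

/-! ### Metric hypersurface data -/

/-- Metric hypersurface data `{N, γ, ℓ, ℓ⁽²⁾}` on an `m`-dimensional manifold `N`: a smooth
symmetric two-covariant tensor field, a smooth one-form and a smooth function such that the
form `𝒜` on `T_pN × ℝ` is nondegenerate at every point. No signature is prescribed, and `γ` may
be degenerate. -/
structure MetricHypersurfaceData (m : ℕ) (N : Type*) [TopologicalSpace N]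
    [ChartedSpace (EuclideanSpace ℝ (Fin m)) N] [IsManifold (𝓡 m) ∞ N] where
  /-- the symmetric two-covariant tensor field -/
  γ : ∀ x : N, TangentSpace (𝓡 m) x →L[ℝ] TangentSpace (𝓡 m) x →L[ℝ] ℝ
  /-- the one-form -/
  ell : ∀ x : N, TangentSpace (𝓡 m) x →L[ℝ] ℝ
  /-- the scalar field -/
  ell₂ : N → ℝ
  γ_symm : ∀ (x : N) (v w : TangentSpace (𝓡 m) x), γ x v w = γ x w v
  γ_smooth : ContMDiff (𝓡 m)
    ((𝓡 m).prod 𝓘(ℝ, EuclideanSpace ℝ (Fin m) →L[ℝ] EuclideanSpace ℝ (Fin m) →L[ℝ] ℝ)) ∞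
    (fun x ↦ TotalSpace.mk'
      (EuclideanSpace ℝ (Fin m) →L[ℝ] EuclideanSpace ℝ (Fin m) →L[ℝ] ℝ) x (γ x))
  ell_smooth : ContMDiff (𝓡 m) ((𝓡 m).prod 𝓘(ℝ, EuclideanSpace ℝ (Fin m) →L[ℝ] ℝ)) ∞
    (fun x ↦ TotalSpace.mk' (EuclideanSpace ℝ (Fin m) →L[ℝ] ℝ) x (ell x))
  ell₂_smooth : ContMDiff (𝓡 m) 𝓘(ℝ, ℝ) ∞ ell₂
  nondegenerate : ∀ x : N, (ambientForm (γ x) (ell x) (ell₂ x)).Nondegenerate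

/-- The coordinate vector field `∂_a` of a chart `e` (meaningful on the domain of `e`). -/
def coordField {m : ℕ} {N : Type*} [TopologicalSpace N]
    [ChartedSpace (EuclideanSpace ℝ (Fin m)) N]
    (e : OpenPartialHomeomorph N (EuclideanSpace ℝ (Fin m))) (a : Fin m) :
    ∀ x : N, TangentSpace (𝓡 m) x :=
  VectorField.mpullback (𝓡 m) 𝓘(ℝ, EuclideanSpace ℝ (Fin m)) e
    (fun _ ↦ EuclideanSpace.single a (1 : ℝ))

/-- The coordinate one-form `dx^a` of a chart `e` (meaningful on the domain of `e`). -/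
def coordForm {m : ℕ} {N : Type*} [TopologicalSpace N]
    [ChartedSpace (EuclideanSpace ℝ (Fin m)) N]
    (e : OpenPartialHomeomorph N (EuclideanSpace ℝ (Fin m))) (a : Fin m) (x : N) :
    TangentSpace (𝓡 m) x →L[ℝ] ℝ :=
  mvfderiv (𝓡 m) (fun y : N ↦ e y a) x

namespace MetricHypersurfaceData

variable {m : ℕ} {N : Type*} [TopologicalSpace N]
  [ChartedSpace (EuclideanSpace ℝ (Fin m)) N] [IsManifold (𝓡 m) ∞ N]
  (D : MetricHypersurfaceData m N)

instance tangent_finiteDimensional (x : N) : FiniteDimensional ℝ (TangentSpace (𝓡 m) x) :=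
  inferInstanceAs (FiniteDimensional ℝ (EuclideanSpace ℝ (Fin m)))

/-- The tensor `𝒜♯` at `x`, evaluated on `(α, a)` and `(β, b)` in `T_x*N × ℝ`. -/
def Asharp (x : N) (α : Module.Dual ℝ (TangentSpace (𝓡 m) x)) (a : ℝ)
    (β : Module.Dual ℝ (TangentSpace (𝓡 m) x)) (b : ℝ) : ℝ :=
  sharpForm (ambientForm (D.γ x) (D.ell x) (D.ell₂ x)) (D.nondegenerate x)
    (dualPair α a) (dualPair β b)

/-- The part `P` of `𝒜♯`. -/
def P (x : N) (α β : Module.Dual ℝ (TangentSpace (𝓡 m) x)) : ℝ := D.Asharp x α 0 β 0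

/-- The vector field `n` in the decomposition of `𝒜♯`, i.e. the tangent vector with
`α(n) = 𝒜♯((α,0),(0,1))` for every covector `α`. -/
def n (x : N) : TangentSpace (𝓡 m) x :=
  (((ambientForm (D.γ x) (D.ell x) (D.ell₂ x)).toDual (D.nondegenerate x)).symm
    (dualPair 0 1)).1

/-- The scalar field `n⁽²⁾`. -/
def n₂ (x : N) : ℝ := D.Asharp x 0 1 0 1

lemma apply_n (x : N) (α : Module.Dual ℝ (TangentSpace (𝓡 m) x)) :
    α (D.n x) = D.Asharp x α 0 0 1 := by
  simp [n, Asharp, sharpForm, dualPair]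

lemma ambientForm_n {x : N} (p : TangentSpace (𝓡 m) x × ℝ) :
    ambientForm (D.γ x) (D.ell x) (D.ell₂ x) (D.n x, D.n₂ x) p = dualPair 0 1 p := by
  have e : (D.n x, D.n₂ x) =
      ((ambientForm (D.γ x) (D.ell x) (D.ell₂ x)).toDual (D.nondegenerate x)).symm
        (dualPair 0 1) := by
    ext1
    · rfl
    · simp [n₂, Asharp, sharpForm, dualPair]
  rw [e, LinearMap.BilinForm.apply_toDual_symm_apply]

/-- `𝒜` and `𝒜♯` invert each other: the four relations defining `P`, `n` and `n⁽²⁾`. -/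
lemma γ_n (x : N) (v : TangentSpace (𝓡 m) x) :
    D.γ x (D.n x) v + D.n₂ x * D.ell x v = 0 := by
  have h := D.ambientForm_n (v, 0)
  simpa [ambientForm, dualPair] using h

lemma ell_n (x : N) : D.ell x (D.n x) + D.n₂ x * D.ell₂ x = 1 := by
  have h := D.ambientForm_n (x := x) (0, 1)
  simpa [ambientForm, dualPair] using h

lemma P_ell (x : N) (α : Module.Dual ℝ (TangentSpace (𝓡 m) x)) :
    D.P x α (D.ell x).toLinearMap + D.ell₂ x * α (D.n x) = 0 := by
  have h := sharpForm_apply _ (D.nondegenerate x) (dualPair α 0) (0, 1)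
  have e : ambientForm (D.γ x) (D.ell x) (D.ell₂ x) (0, 1) =
      dualPair (D.ell x).toLinearMap 0 + D.ell₂ x • dualPair 0 1 := by
    ext v <;> simp [ambientForm, dualPair]
  rw [e] at h
  rw [apply_n]
  simpa [P, Asharp, sharpForm, dualPair] using h

lemma P_γ (x : N) (α : Module.Dual ℝ (TangentSpace (𝓡 m) x)) (v : TangentSpace (𝓡 m) x) :
    D.P x α (D.γ x v).toLinearMap + D.ell x v * α (D.n x) = α v := by
  have h := sharpForm_apply _ (D.nondegenerate x) (dualPair α 0) (v, 0)
  have e : ambientForm (D.γ x) (D.ell x) (D.ell₂ x) (v, 0) =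
      dualPair (D.γ x v).toLinearMap 0 + D.ell x v • dualPair 0 1 := by
    ext v <;> simp [ambientForm, dualPair]
  rw [e] at h
  rw [apply_n]
  simpa [P, Asharp, sharpForm, dualPair] using h

/-- The function `γ(X, Z)`. -/
def gam (X Z : ∀ x : N, TangentSpace (𝓡 m) x) (x : N) : ℝ := D.γ x (X x) (Z x)

/-- The Lie derivative `(£_n γ)(X, Z) = n(γ(X,Z)) - γ([n,X],Z) - γ(X,[n,Z])`. -/
def lieGamma (X Z : ∀ x : N, TangentSpace (𝓡 m) x) (x : N) : ℝ :=
  mvfderiv (𝓡 m) (D.gam X Z) x (D.n x)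
    - D.γ x (VectorField.mlieBracket (𝓡 m) D.n X x) (Z x)
    - D.γ x (X x) (VectorField.mlieBracket (𝓡 m) D.n Z x)

/-- The tensor `U = ½ £_n γ + ℓ ⊗ₛ dn⁽²⁾`, evaluated on vector fields, where
`α ⊗ₛ β = ½ (α ⊗ β + β ⊗ α)`. -/
def U (X Z : ∀ x : N, TangentSpace (𝓡 m) x) (x : N) : ℝ :=
  (1 / 2) * D.lieGamma X Z x +
    (1 / 2) * (D.ell x (X x) * mvfderiv (𝓡 m) D.n₂ x (Z x) +
      D.ell x (Z x) * mvfderiv (𝓡 m) D.n₂ x (X x))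

/-- `(∇_X γ)(Z, W) = X(γ(Z,W)) - γ(∇_X Z, W) - γ(Z, ∇_X W)`. -/
def covGamma
    (nabla : CovariantDerivative (𝓡 m) (EuclideanSpace ℝ (Fin m))
      (TangentSpace (𝓡 m) : N → Type _))
    (X Z W : ∀ x : N, TangentSpace (𝓡 m) x) (x : N) : ℝ :=
  mvfderiv (𝓡 m) (D.gam Z W) x (X x)
    - D.γ x (nabla Z x (X x)) (W x) - D.γ x (Z x) (nabla W x (X x))

/-- `(∇_X ℓ)(Z) = X(ℓ(Z)) - ℓ(∇_X Z)`. -/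
def covEll
    (nabla : CovariantDerivative (𝓡 m) (EuclideanSpace ℝ (Fin m))
      (TangentSpace (𝓡 m) : N → Type _))
    (X Z : ∀ x : N, TangentSpace (𝓡 m) x) (x : N) : ℝ :=
  mvfderiv (𝓡 m) (fun y ↦ D.ell y (Z y)) x (X x) - D.ell x (nabla Z x (X x))

/-- The defining properties of a metric hypersurface connection: a smooth torsion-free
connection on `TN` with, for all smooth vector fields `X, Z, W`,
`(∇_X γ)(Z,W) = -U(X,Z) ℓ(W) - U(X,W) ℓ(Z)` and
`(∇_X ℓ)(Z) + (∇_Z ℓ)(X) = -2 ℓ⁽²⁾ U(X,Z)`.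
In Mathlib's argument order, `nabla Z x (X x)` is `∇_X Z` at `x`. -/
structure IsMetricHypersurfaceConnection
    (nabla : CovariantDerivative (𝓡 m) (EuclideanSpace ℝ (Fin m))
      (TangentSpace (𝓡 m) : N → Type _)) : Prop where
  smooth : nabla.ContMDiffCovariantDerivative ∞
  torsion_free : nabla.torsion = 0
  cov_gamma : ∀ X Z W : Cₛ^∞⟮𝓡 m; EuclideanSpace ℝ (Fin m), (TangentSpace (𝓡 m) : N → Type _)⟯,
    ∀ x : N, D.covGamma nabla X Z W x =
      - D.U X Z x * D.ell x (W x) - D.U X W x * D.ell x (Z x)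
  cov_ell : ∀ X Z : Cₛ^∞⟮𝓡 m; EuclideanSpace ℝ (Fin m), (TangentSpace (𝓡 m) : N → Type _)⟯,
    ∀ x : N, D.covEll nabla X Z x + D.covEll nabla Z X x = - 2 * D.ell₂ x * D.U X Z x

/-- The components `γ_{ab}` in a chart. -/
def γComp (e : OpenPartialHomeomorph N (EuclideanSpace ℝ (Fin m))) (a b : Fin m) (x : N) : ℝ :=
  D.γ x (coordField e a x) (coordField e b x)

/-- The components `ℓ_a` in a chart. -/
def ellComp (e : OpenPartialHomeomorph N (EuclideanSpace ℝ (Fin m))) (a : Fin m) (x : N) : ℝ :=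
  D.ell x (coordField e a x)

/-- The components `P^{ab} = P(dx^a, dx^b)` in a chart. -/
def PComp (e : OpenPartialHomeomorph N (EuclideanSpace ℝ (Fin m))) (a b : Fin m) (x : N) : ℝ :=
  D.P x (coordForm e a x).toLinearMap (coordForm e b x).toLinearMap

/-- The components `n^a = dx^a(n)` in a chart. -/
def nComp (e : OpenPartialHomeomorph N (EuclideanSpace ℝ (Fin m))) (a : Fin m) (x : N) : ℝ :=
  coordForm e a x (D.n x)

end MetricHypersurfaceData

/-- The partial derivative `∂_a f` of a function in a chart, at a point of the chart domain. -/
def coordPartial {m : ℕ} {N : Type*} [TopologicalSpace N]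
    (e : OpenPartialHomeomorph N (EuclideanSpace ℝ (Fin m))) (a : Fin m) (f : N → ℝ) (x : N) : ℝ :=
  fderiv ℝ (f ∘ e.symm) (e x) (EuclideanSpace.single a (1 : ℝ))

namespace MetricHypersurfaceData

/-- `Γ^c_{ab} = ½ P^{cd} (∂_a γ_{bd} + ∂_b γ_{ad} - ∂_d γ_{ab}) + ½ n^c (∂_a ℓ_b + ∂_b ℓ_a)`. -/
def christoffel {m : ℕ} {N : Type*} [TopologicalSpace N]
    [ChartedSpace (EuclideanSpace ℝ (Fin m)) N] [IsManifold (𝓡 m) ∞ N]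
    (D : MetricHypersurfaceData m N)
    (e : OpenPartialHomeomorph N (EuclideanSpace ℝ (Fin m))) (c a b : Fin m) (x : N) : ℝ :=
  (1 / 2) * ∑ d, D.PComp e c d x *
      (coordPartial e a (D.γComp e b d) x + coordPartial e b (D.γComp e a d) x
        - coordPartial e d (D.γComp e a b) x)
    + (1 / 2) * D.nComp e c x *
      (coordPartial e a (D.ellComp e b) x + coordPartial e b (D.ellComp e a) x)

end MetricHypersurfaceData

end

noncomputable section

open HypersurfaceAlgebra Topology Filter

/-! This is the Koszul argument, run on `TN ⊕ ℝ` with the nondegenerate form `𝒜` in place of the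
possibly degenerate `γ`.

Write `K(X,Z,W)` for the Koszul expression of `γ` and `k(X,Z)` for its analogue for `ℓ` (`koszul`,
`koszulEll`). For a torsion-free connection, permuting the `γ`-equation cyclically gives `γ(∇_X Z,
W) = ½ K(X,Z,W) + U(X,Z) ℓ(W)`, and the `ℓ`-equation gives `ℓ(∇_X Z) = ½ k(X,Z) + U(X,Z) ℓ⁽²⁾`.
Together they say `𝒜((∇_X Z, -U(X,Z)), (W,b)) = ½ K(X,Z,W) + ½ b k(X,Z)`. The right side is
tensorial in `W`, so nondegeneracy determines `∇_X Z`, whence uniqueness.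

For existence, let `(v,c)` solve this linear system and put `∇_X Z := v`. The point is that `c =
-U(X,Z)` holds automatically: since `𝒜((n,n⁽²⁾),·)` is the projection to `ℝ`, testing against
`(n,n⁽²⁾)` isolates `c`, and `koszul_n` evaluates the right side as `-U(X,Z)`. The resulting
formulas, `nablaFun_spec`, yield the Leibniz rule, zero torsion and both covariant-derivative
equations by symmetries of `K`, `k` and `U`.

Smoothness follows from Cramer's rule in a local frame (`smooth_of_ambientForm`). The Christoffel
symbols come from inverting `𝒜` with `P_γ`; the terms in `U` then vanish by `P_ell`. -/

lemma isManifold_minSmoothness_two {m : ℕ} {N : Type*} [TopologicalSpace N]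
    [ChartedSpace (EuclideanSpace ℝ (Fin m)) N] [IsManifold (𝓡 m) ∞ N] :
    IsManifold (𝓡 m) (minSmoothness ℝ 2) N := by
  rw [minSmoothness_of_isRCLikeNormedField]
  infer_instance

attribute [local instance] isManifold_minSmoothness_two

/-! ### Smooth vector fields and extension of tangent vectors -/

section Calculus

variable {m : ℕ} {N : Type*} [TopologicalSpace N]
  [ChartedSpace (EuclideanSpace ℝ (Fin m)) N] [IsManifold (𝓡 m) ∞ N]

/-- Smoothness of a vector field at a point. -/
abbrev SmoothFieldAt (X : ∀ x : N, TangentSpace (𝓡 m) x) (x : N) : Prop :=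
  ContMDiffAt (𝓡 m) ((𝓡 m).prod 𝓘(ℝ, EuclideanSpace ℝ (Fin m))) ∞
    (fun y ↦ TotalSpace.mk' (EuclideanSpace ℝ (Fin m)) y (X y)) x

/-- Differentiability of a vector field at a point. -/
abbrev DiffFieldAt (X : ∀ x : N, TangentSpace (𝓡 m) x) (x : N) : Prop :=
  MDifferentiableAt (𝓡 m) ((𝓡 m).prod 𝓘(ℝ, EuclideanSpace ℝ (Fin m)))
    (fun y ↦ TotalSpace.mk' (EuclideanSpace ℝ (Fin m)) y (X y)) x

/-- The derivative of a smooth function along a smooth vector field is smooth. -/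
lemma ContMDiffAt.mvfderiv_apply {f : N → ℝ} {X : ∀ x : N, TangentSpace (𝓡 m) x} {x : N}
    (hf : ContMDiffAt (𝓡 m) 𝓘(ℝ, ℝ) ∞ f x) (hX : SmoothFieldAt X x) :
    ContMDiffAt (𝓡 m) 𝓘(ℝ, ℝ) ∞ (fun y ↦ mvfderiv (𝓡 m) f y (X y)) x := by
  have h1 := hf.mfderiv_const (m := ∞) (by simp)
  have h2 := ContMDiffAt.clm_apply_of_inCoordinates (E₁ := (TangentSpace (𝓡 m) : N → Type _))
    (E₂ := (TangentSpace 𝓘(ℝ, ℝ) : ℝ → Type _)) (b₁ := id) (b₂ := f) (v := X) h1 hX hf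
  exact (contMDiff_snd_tangentBundle_modelSpace ℝ 𝓘(ℝ, ℝ)).contMDiffAt.comp x h2

lemma ContMDiffAt.mlieBracket_smooth {X Y : ∀ x : N, TangentSpace (𝓡 m) x} {x : N}
    (hX : SmoothFieldAt X x) (hY : SmoothFieldAt Y x) :
    SmoothFieldAt (VectorField.mlieBracket (𝓡 m) X Y) x :=
  haveI : IsManifold (𝓡 m) ((⊤ : ℕ∞) + 1) N := by simpa using! ‹IsManifold (𝓡 m) ∞ N›
  ContMDiffAt.mlieBracket_vectorField (m := ⊤) (n := ⊤) hX hY (by simp)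

/-- A tangent vector extends to a global smooth vector field. -/
lemma exists_smooth_extension [T2Space N] (x : N) (v : TangentSpace (𝓡 m) x) :
    ∃ X : Cₛ^∞⟮𝓡 m; EuclideanSpace ℝ (Fin m), (TangentSpace (𝓡 m) : N → Type _)⟯, X x = v := by
  obtain ⟨f⟩ : Nonempty (SmoothBumpFunction (𝓡 m) x) := inferInstance
  set t := trivializationAt (EuclideanSpace ℝ (Fin m)) (TangentSpace (𝓡 m) : N → Type _) x
  have ht : t.baseSet = (chartAt (EuclideanSpace ℝ (Fin m)) x).source := rfl
  have hs : ContMDiffOn (𝓡 m) ((𝓡 m).prod 𝓘(ℝ, EuclideanSpace ℝ (Fin m))) ∞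
      (fun y ↦ TotalSpace.mk' (EuclideanSpace ℝ (Fin m)) y
        (FiberBundle.extend (EuclideanSpace ℝ (Fin m)) v y)) t.baseSet := by
    rw [t.contMDiffOn_section_baseSet_iff]
    apply (contMDiffOn_const (c := (t ⟨x, v⟩).2)).congr
    intro y hy
    simp [FiberBundle.extend, t, Bundle.Trivialization.apply_mk_symm _ hy]
  -- The local extension has constant coordinates in the trivialization, hence is smooth on its
  -- domain. The bump function equals 1 at `x` and has closed support there, so the product is
  -- globally smooth; Hausdorffness is needed for this cut-off.
  refine ⟨⟨(f : N → ℝ) • FiberBundle.extend (EuclideanSpace ℝ (Fin m)) v, ?_⟩, ?_⟩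
  · exact ContMDiffOn.smul_section_of_tsupport f.contMDiff.contMDiffOn t.open_baseSet
      (ht ▸ f.tsupport_subset_chartAt_source) hs
  · change f x • FiberBundle.extend (EuclideanSpace ℝ (Fin m)) v x = v
    simp

end Calculus

/-! ### Regularity of `γ(X,Z)` and `ℓ(X)` -/

namespace MetricHypersurfaceData

variable {m : ℕ} {N : Type*} [TopologicalSpace N]
  [ChartedSpace (EuclideanSpace ℝ (Fin m)) N] [IsManifold (𝓡 m) ∞ N]
  (D : MetricHypersurfaceData m N) {X Z : ∀ x : N, TangentSpace (𝓡 m) x} {x : N}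

lemma contMDiffAt_gam (hX : SmoothFieldAt X x) (hZ : SmoothFieldAt Z x) :
    ContMDiffAt (𝓡 m) 𝓘(ℝ, ℝ) ∞ (D.gam X Z) x := by
  have : ContMDiffAt (𝓡 m) ((𝓡 m).prod 𝓘(ℝ)) ∞
      (fun y ↦ TotalSpace.mk' ℝ (E := Bundle.Trivial N ℝ) y (D.γ y (X y) (Z y))) x :=
    ContMDiffAt.clm_bundle_apply₂ (F₁ := EuclideanSpace ℝ (Fin m))
      (F₂ := EuclideanSpace ℝ (Fin m)) D.γ_smooth.contMDiffAt hX hZ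
  simp only [contMDiffAt_totalSpace] at this
  exact this.2

lemma contMDiffAt_ell (hX : SmoothFieldAt X x) :
    ContMDiffAt (𝓡 m) 𝓘(ℝ, ℝ) ∞ (fun y ↦ D.ell y (X y)) x := by
  have : ContMDiffAt (𝓡 m) ((𝓡 m).prod 𝓘(ℝ)) ∞
      (fun y ↦ TotalSpace.mk' ℝ (E := Bundle.Trivial N ℝ) y (D.ell y (X y))) x :=
    ContMDiffAt.clm_bundle_apply (F₁ := EuclideanSpace ℝ (Fin m)) D.ell_smooth.contMDiffAt hX
  simp only [contMDiffAt_totalSpace] at this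
  exact this.2

lemma mdifferentiableAt_gam (hX : DiffFieldAt X x) (hZ : DiffFieldAt Z x) :
    MDifferentiableAt (𝓡 m) 𝓘(ℝ, ℝ) (D.gam X Z) x := by
  have : MDifferentiableAt (𝓡 m) ((𝓡 m).prod 𝓘(ℝ))
      (fun y ↦ TotalSpace.mk' ℝ (E := Bundle.Trivial N ℝ) y (D.γ y (X y) (Z y))) x :=
    MDifferentiableAt.clm_bundle_apply₂ (F₁ := EuclideanSpace ℝ (Fin m))
      (F₂ := EuclideanSpace ℝ (Fin m)) (D.γ_smooth.mdifferentiableAt (by simp)) hX hZ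
  simp only [mdifferentiableAt_totalSpace] at this
  exact this.2

lemma mdifferentiableAt_ell (hX : DiffFieldAt X x) :
    MDifferentiableAt (𝓡 m) 𝓘(ℝ, ℝ) (fun y ↦ D.ell y (X y)) x := by
  have : MDifferentiableAt (𝓡 m) ((𝓡 m).prod 𝓘(ℝ))
      (fun y ↦ TotalSpace.mk' ℝ (E := Bundle.Trivial N ℝ) y (D.ell y (X y))) x :=
    MDifferentiableAt.clm_bundle_apply (F₁ := EuclideanSpace ℝ (Fin m))
      (D.ell_smooth.mdifferentiableAt (by simp)) hX
  simp only [mdifferentiableAt_totalSpace] at this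
  exact this.2

lemma gam_comm (X Z : ∀ x : N, TangentSpace (𝓡 m) x) : D.gam X Z = D.gam Z X :=
  funext fun y ↦ D.γ_symm y _ _

end MetricHypersurfaceData

/-! ### Cramer's rule with smooth coefficients -/

section SmoothMatrices

variable {m : ℕ} {N : Type*} [TopologicalSpace N]
  [ChartedSpace (EuclideanSpace ℝ (Fin m)) N] {ι : Type*} [Fintype ι] [DecidableEq ι]
  {x : N}

lemma ContMDiffAt.matrix_det {A : N → Matrix ι ι ℝ}
    (hA : ∀ i j, ContMDiffAt (𝓡 m) 𝓘(ℝ, ℝ) ∞ (fun y ↦ A y i j) x) :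
    ContMDiffAt (𝓡 m) 𝓘(ℝ, ℝ) ∞ (fun y ↦ (A y).det) x := by
  simp only [Matrix.det_apply]
  refine contMDiffAt_finsetSum fun σ _ ↦ ?_
  have : ContMDiffAt (𝓡 m) 𝓘(ℝ, ℝ) ∞ (fun y ↦ ∏ i, A y (σ i) i) x :=
    contMDiffAt_finsetProd fun i _ ↦ hA _ _
  have h2 := (contMDiffAt_const (c := (((Equiv.Perm.sign σ : ℤˣ) : ℤ) : ℝ))).mul this
  refine h2.congr_of_eventuallyEq (Eventually.of_forall fun y ↦ ?_)
  simp [Units.smul_def]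

/-- The solution of a smooth linear system that is regular at a point is smooth there. -/
lemma ContMDiffAt.of_mulVec {A : N → Matrix ι ι ℝ} {u r : N → ι → ℝ}
    (hA : ∀ i j, ContMDiffAt (𝓡 m) 𝓘(ℝ, ℝ) ∞ (fun y ↦ A y i j) x) (hdet : (A x).det ≠ 0)
    (hr : ∀ i, ContMDiffAt (𝓡 m) 𝓘(ℝ, ℝ) ∞ (fun y ↦ r y i) x)
    (h : ∀ᶠ y in 𝓝 x, Matrix.mulVec (A y) (u y) = r y) (i : ι) :
    ContMDiffAt (𝓡 m) 𝓘(ℝ, ℝ) ∞ (fun y ↦ u y i) x := by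
  have hd := ContMDiffAt.matrix_det hA
  have hc : ContMDiffAt (𝓡 m) 𝓘(ℝ, ℝ) ∞ (fun y ↦ ((A y).updateCol i (r y)).det) x := by
    refine ContMDiffAt.matrix_det fun j k ↦ ?_
    by_cases hk : k = i
    · subst hk; simpa using hr j
    · simpa [Matrix.updateCol_apply, hk] using hA j k
  have hinv : ContMDiffAt (𝓡 m) 𝓘(ℝ, ℝ) ∞ (fun y ↦ ((A y).det)⁻¹) x := hd.inv₀ hdet
  refine (hinv.mul hc).congr_of_eventuallyEq ?_
  filter_upwards [h, hd.continuousAt.eventually_ne hdet] with y hy hne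
  -- Cramer's rule writes `u i` as a quotient of determinants, which are polynomial in the smooth
  -- data; the denominator stays nonzero near `x` by continuity.
  have e : Matrix.cramer (A y) (r y) = (A y).det • u y := by
    rw [Matrix.cramer_eq_adjugate_mulVec, ← hy, Matrix.mulVec_mulVec, Matrix.adjugate_mul,
      Matrix.smul_mulVec, Matrix.one_mulVec]
  have e2 := congrFun e i
  rw [Matrix.cramer_apply] at e2
  simp only [Pi.smul_apply, smul_eq_mul] at e2
  simp only [Pi.mul_apply, e2]
  field_simp

end SmoothMatrices

/-! ### Smoothness of `n` and `n⁽²⁾` -/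

namespace MetricHypersurfaceData

variable {m : ℕ} {N : Type*} [TopologicalSpace N]
  [ChartedSpace (EuclideanSpace ℝ (Fin m)) N] [IsManifold (𝓡 m) ∞ N]
  (D : MetricHypersurfaceData m N) {X X' Z Z' W W' : ∀ x : N, TangentSpace (𝓡 m) x} {x : N}
  {f : N → ℝ}

/-- A section of `TN ⊕ ℝ` whose contraction with `𝒜` is smooth is smooth. -/
lemma smooth_of_ambientForm {v : ∀ x : N, TangentSpace (𝓡 m) x} {a : N → ℝ}
    (h₁ : ∀ W : ∀ x : N, TangentSpace (𝓡 m) x, SmoothFieldAt W x →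
      ContMDiffAt (𝓡 m) 𝓘(ℝ, ℝ) ∞ (fun y ↦ D.γ y (v y) (W y) + a y * D.ell y (W y)) x)
    (h₂ : ContMDiffAt (𝓡 m) 𝓘(ℝ, ℝ) ∞ (fun y ↦ D.ell y (v y) + a y * D.ell₂ y) x) :
    SmoothFieldAt v x ∧ ContMDiffAt (𝓡 m) 𝓘(ℝ, ℝ) ∞ a x := by
  set t := trivializationAt (EuclideanSpace ℝ (Fin m)) (TangentSpace (𝓡 m) : N → Type _) x
  have hx : x ∈ t.baseSet := FiberBundle.mem_baseSet_trivializationAt' x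
  set b := (EuclideanSpace.basisFun (Fin m) ℝ).toBasis
  set s := t.localFrame b
  have hs : ∀ i, SmoothFieldAt (s i) x := fun i ↦ contMDiffAt_localFrame_of_mem ∞ t b i hx
  -- A local frame of `TN ⊕ ℝ`. Its Gram matrix for `𝒜` is the coefficient matrix of the system
  -- solved by the components of `(v, a)`, and it is invertible at `x` because `𝒜` is nondegenerate.
  let q : Fin m ⊕ Unit → ∀ y : N, TangentSpace (𝓡 m) y × ℝ :=
    Sum.elim (fun i y ↦ (s i y, 0)) (fun _ y ↦ (0, 1))
  let A : N → Matrix (Fin m ⊕ Unit) (Fin m ⊕ Unit) ℝ := fun y ↦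
    Matrix.of fun i j ↦ ambientForm (D.γ y) (D.ell y) (D.ell₂ y) (q j y) (q i y)
  have hA : ∀ i j, ContMDiffAt (𝓡 m) 𝓘(ℝ, ℝ) ∞ (fun y ↦ A y i j) x := by
    rintro (i | i) (j | j)
    · simpa [A, q, ambientForm] using! D.contMDiffAt_gam (hs j) (hs i)
    · simpa [A, q, ambientForm] using! D.contMDiffAt_ell (hs i)
    · simpa [A, q, ambientForm] using! D.contMDiffAt_ell (hs j)
    · simpa [A, q, ambientForm] using! D.ell₂_smooth.contMDiffAt
  have hdet : (A x).det ≠ 0 := by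
    let B := (t.basisAt b hx).prod (Module.Basis.singleton Unit ℝ)
    have hB : (A x).transpose = LinearMap.BilinForm.toMatrix B
        (ambientForm (D.γ x) (D.ell x) (D.ell₂ x)) := by
      ext i j
      rw [LinearMap.BilinForm.toMatrix_apply, Matrix.transpose_apply]
      have hq : ∀ i, q i x = B i := by
        rintro (i | i) <;> simp [q, B, s, hx]
      simp only [A, Matrix.of_apply, hq]
    rw [← Matrix.det_transpose, hB]
    exact (LinearMap.BilinForm.nondegenerate_iff_det_ne_zero B).1 (D.nondegenerate x)
  let u : N → Fin m ⊕ Unit → ℝ := fun y ↦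
    Sum.elim (fun i ↦ t.localFrameCoeff (𝓡 m) b i y (v y)) (fun _ ↦ a y)
  let r : N → Fin m ⊕ Unit → ℝ := fun y i ↦
    ambientForm (D.γ y) (D.ell y) (D.ell₂ y) (v y, a y) (q i y)
  have hr : ∀ i, ContMDiffAt (𝓡 m) 𝓘(ℝ, ℝ) ∞ (fun y ↦ r y i) x := by
    rintro (i | i)
    · simpa [r, q, ambientForm] using! h₁ _ (hs i)
    · simpa [r, q, ambientForm] using! h₂
  have hAu : ∀ᶠ y in 𝓝 x, Matrix.mulVec (A y) (u y) = r y := by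
    filter_upwards [t.open_baseSet.mem_nhds hx] with y hy
    have hv : (v y, a y) = ∑ j, u y j • q j y := by
      have := t.eq_sum_localFrameCoeff_smul (I := 𝓡 m) (b := b) (s := v) hy
      rw [Fintype.sum_sum_type]
      ext1
      · simpa [u, q, Prod.fst_sum] using this
      · simp [u, q, Prod.snd_sum]
    ext i
    simp only [r, hv, map_sum, map_smul, LinearMap.sum_apply, LinearMap.smul_apply]
    simp [Matrix.mulVec, dotProduct, A, mul_comm]
  have key := ContMDiffAt.of_mulVec hA hdet hr hAu
  refine ⟨?_, key (Sum.inr ())⟩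
  exact (contMDiffAt_iff_localFrameCoeff b hx).2 fun i ↦ key (Sum.inl i)

/-- Pairing `(n, n⁽²⁾)` with `(W,0)` gives 0 and with `(0,1)` gives 1, so the data of the linear
system are constant. -/
lemma smooth_n_n₂ (x : N) : SmoothFieldAt D.n x ∧ ContMDiffAt (𝓡 m) 𝓘(ℝ, ℝ) ∞ D.n₂ x :=
  D.smooth_of_ambientForm
    (fun W _ ↦ by simpa only [D.γ_n] using contMDiffAt_const)
    (by simpa only [D.ell_n] using contMDiffAt_const)

/-! ### Koszul expressions and their tensoriality -/

/-- The Koszul expression of `γ`. -/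
def koszul (X Z W : ∀ x : N, TangentSpace (𝓡 m) x) (x : N) : ℝ :=
  mvfderiv (𝓡 m) (D.gam Z W) x (X x) + mvfderiv (𝓡 m) (D.gam X W) x (Z x)
    - mvfderiv (𝓡 m) (D.gam X Z) x (W x)
    + D.γ x (VectorField.mlieBracket (𝓡 m) X Z x) (W x)
    - D.γ x (VectorField.mlieBracket (𝓡 m) X W x) (Z x)
    - D.γ x (VectorField.mlieBracket (𝓡 m) Z W x) (X x)

/-- The function `ℓ(X)`. -/
def ellField (X : ∀ x : N, TangentSpace (𝓡 m) x) (x : N) : ℝ := D.ell x (X x)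

lemma mdifferentiableAt_ellField (hX : DiffFieldAt X x) :
    MDifferentiableAt (𝓡 m) 𝓘(ℝ, ℝ) (D.ellField X) x := D.mdifferentiableAt_ell hX

/-- The analogue of the Koszul expression for the one-form `ℓ`. -/
def koszulEll (X Z : ∀ x : N, TangentSpace (𝓡 m) x) (x : N) : ℝ :=
  mvfderiv (𝓡 m) (D.ellField Z) x (X x)
    + mvfderiv (𝓡 m) (D.ellField X) x (Z x)
    + D.ell x (VectorField.mlieBracket (𝓡 m) X Z x)

lemma gam_add_left (X X' Z : ∀ x : N, TangentSpace (𝓡 m) x) :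
    D.gam (X + X') Z = D.gam X Z + D.gam X' Z := by ext; simp [gam]

lemma gam_add_right (X Z Z' : ∀ x : N, TangentSpace (𝓡 m) x) :
    D.gam X (Z + Z') = D.gam X Z + D.gam X Z' := by ext; simp [gam]

lemma gam_smul_left (f : N → ℝ) (X Z : ∀ x : N, TangentSpace (𝓡 m) x) :
    D.gam (f • X) Z = f * D.gam X Z := by ext; simp [gam]

lemma gam_smul_right (f : N → ℝ) (X Z : ∀ x : N, TangentSpace (𝓡 m) x) :
    D.gam X (f • Z) = f * D.gam X Z := by ext; simp [gam]

lemma ellField_add (X X' : ∀ x : N, TangentSpace (𝓡 m) x) :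
    D.ellField (X + X') = D.ellField X + D.ellField X' := by ext; simp [ellField]

lemma ellField_smul (f : N → ℝ) (X : ∀ x : N, TangentSpace (𝓡 m) x) :
    D.ellField (f • X) = f * D.ellField X := by ext; simp [ellField]

lemma koszul_add_left (hX : DiffFieldAt X x) (hX' : DiffFieldAt X' x) (hZ : DiffFieldAt Z x)
    (hW : DiffFieldAt W x) :
    D.koszul (X + X') Z W x = D.koszul X Z W x + D.koszul X' Z W x := by
  simp only [koszul, gam_add_left, VectorField.mlieBracket_add_left hX hX',
    mvfderiv_add (D.mdifferentiableAt_gam hX hW) (D.mdifferentiableAt_gam hX' hW),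
    mvfderiv_add (D.mdifferentiableAt_gam hX hZ) (D.mdifferentiableAt_gam hX' hZ),
    Pi.add_apply, map_add, add_apply]
  ring

/-- The derivatives of `f` along `Z` and `W` produced by the first-order terms cancel those produced
by the brackets. -/
lemma koszul_smul_left (hf : MDifferentiableAt (𝓡 m) 𝓘(ℝ, ℝ) f x) (hX : DiffFieldAt X x)
    (hZ : DiffFieldAt Z x) (hW : DiffFieldAt W x) :
    D.koszul (f • X) Z W x = f x * D.koszul X Z W x := by
  simp only [koszul, gam_smul_left, VectorField.mlieBracket_smul_left hf hX,
    mvfderiv_mul hf (D.mdifferentiableAt_gam hX hW),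
    mvfderiv_mul hf (D.mdifferentiableAt_gam hX hZ),
    Pi.smul_apply', map_add, map_smul, add_apply,
    smul_apply, smul_eq_mul]
  simp only [gam]
  ring

lemma koszul_add_right (hX : DiffFieldAt X x) (hZ : DiffFieldAt Z x) (hW : DiffFieldAt W x)
    (hW' : DiffFieldAt W' x) :
    D.koszul X Z (W + W') x = D.koszul X Z W x + D.koszul X Z W' x := by
  simp only [koszul, gam_add_right, VectorField.mlieBracket_add_right hW hW',
    mvfderiv_add (D.mdifferentiableAt_gam hX hW) (D.mdifferentiableAt_gam hX hW'),
    mvfderiv_add (D.mdifferentiableAt_gam hZ hW) (D.mdifferentiableAt_gam hZ hW'),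
    Pi.add_apply, map_add, add_apply]
  ring

lemma koszul_smul_right (hf : MDifferentiableAt (𝓡 m) 𝓘(ℝ, ℝ) f x) (hX : DiffFieldAt X x)
    (hZ : DiffFieldAt Z x) (hW : DiffFieldAt W x) :
    D.koszul X Z (f • W) x = f x * D.koszul X Z W x := by
  simp only [koszul, gam_smul_right, VectorField.mlieBracket_smul_right hf hW,
    mvfderiv_mul hf (D.mdifferentiableAt_gam hX hW),
    mvfderiv_mul hf (D.mdifferentiableAt_gam hZ hW),
    Pi.smul_apply', map_add, map_smul, add_apply,
    smul_apply, smul_eq_mul]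
  simp only [gam, D.γ_symm x (W x)]
  ring

lemma koszul_add_middle (hX : DiffFieldAt X x) (hZ : DiffFieldAt Z x) (hZ' : DiffFieldAt Z' x)
    (hW : DiffFieldAt W x) :
    D.koszul X (Z + Z') W x = D.koszul X Z W x + D.koszul X Z' W x := by
  simp only [koszul, gam_add_left, gam_add_right, VectorField.mlieBracket_add_right hZ hZ',
    VectorField.mlieBracket_add_left hZ hZ',
    mvfderiv_add (D.mdifferentiableAt_gam hZ hW) (D.mdifferentiableAt_gam hZ' hW),
    mvfderiv_add (D.mdifferentiableAt_gam hX hZ) (D.mdifferentiableAt_gam hX hZ'),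
    Pi.add_apply, map_add, add_apply]
  ring

/-- Here the derivative of `f` along `W` cancels, but the one along `X` occurs twice, once from
`X(γ(Z,W))` and once from `[X,Z]`. Half of it is the Leibniz term of a connection. -/
lemma koszul_smul_middle (hf : MDifferentiableAt (𝓡 m) 𝓘(ℝ, ℝ) f x) (hX : DiffFieldAt X x)
    (hZ : DiffFieldAt Z x) (hW : DiffFieldAt W x) :
    D.koszul X (f • Z) W x =
      f x * D.koszul X Z W x + 2 * mvfderiv (𝓡 m) f x (X x) * D.γ x (Z x) (W x) := by
  simp only [koszul, gam_smul_left, gam_smul_right, VectorField.mlieBracket_smul_right hf hZ,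
    VectorField.mlieBracket_smul_left hf hZ,
    mvfderiv_mul hf (D.mdifferentiableAt_gam hZ hW),
    mvfderiv_mul hf (D.mdifferentiableAt_gam hX hZ),
    Pi.smul_apply', map_add, map_smul, add_apply,
    smul_apply, smul_eq_mul]
  simp only [gam, D.γ_symm x (Z x) (X x)]
  ring

lemma koszulEll_add_left (hX : DiffFieldAt X x) (hX' : DiffFieldAt X' x) :
    D.koszulEll (X + X') Z x = D.koszulEll X Z x + D.koszulEll X' Z x := by
  simp only [koszulEll, ellField_add, VectorField.mlieBracket_add_left hX hX',
    mvfderiv_add (D.mdifferentiableAt_ellField hX) (D.mdifferentiableAt_ellField hX'),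
    Pi.add_apply, map_add, add_apply]
  ring

lemma koszulEll_smul_left (hf : MDifferentiableAt (𝓡 m) 𝓘(ℝ, ℝ) f x) (hX : DiffFieldAt X x) :
    D.koszulEll (f • X) Z x = f x * D.koszulEll X Z x := by
  simp only [koszulEll, ellField_smul, VectorField.mlieBracket_smul_left hf hX,
    mvfderiv_mul hf (D.mdifferentiableAt_ellField hX),
    Pi.smul_apply', map_add, map_smul, add_apply,
    smul_apply, smul_eq_mul]
  simp only [ellField]
  ring

lemma koszulEll_add_right (hZ : DiffFieldAt Z x) (hZ' : DiffFieldAt Z' x) :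
    D.koszulEll X (Z + Z') x = D.koszulEll X Z x + D.koszulEll X Z' x := by
  simp only [koszulEll, ellField_add, VectorField.mlieBracket_add_right hZ hZ',
    mvfderiv_add (D.mdifferentiableAt_ellField hZ) (D.mdifferentiableAt_ellField hZ'),
    Pi.add_apply, map_add, add_apply]
  ring

lemma koszulEll_smul_right (hf : MDifferentiableAt (𝓡 m) 𝓘(ℝ, ℝ) f x) (hZ : DiffFieldAt Z x) :
    D.koszulEll X (f • Z) x =
      f x * D.koszulEll X Z x + 2 * mvfderiv (𝓡 m) f x (X x) * D.ell x (Z x) := by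
  simp only [koszulEll, ellField_smul, VectorField.mlieBracket_smul_right hf hZ,
    mvfderiv_mul hf (D.mdifferentiableAt_ellField hZ),
    Pi.smul_apply', map_add, map_smul, add_apply,
    smul_apply, smul_eq_mul]
  simp only [ellField]
  ring

lemma koszul_tensorial_left (hZ : DiffFieldAt Z x) (W : ∀ x : N, TangentSpace (𝓡 m) x)
    (hW : DiffFieldAt W x) :
    TensorialAt (𝓡 m) (EuclideanSpace ℝ (Fin m)) (fun X ↦ D.koszul X Z W x) x where
  smul hf hX := D.koszul_smul_left hf hX hZ hW
  add hX hX' := D.koszul_add_left hX hX' hZ hW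

lemma koszul_tensorial_right (hZ : DiffFieldAt Z x) (X : ∀ x : N, TangentSpace (𝓡 m) x)
    (hX : DiffFieldAt X x) :
    TensorialAt (𝓡 m) (EuclideanSpace ℝ (Fin m)) (fun W ↦ D.koszul X Z W x) x where
  smul hf hW := D.koszul_smul_right hf hX hZ hW
  add hW hW' := D.koszul_add_right hX hZ hW hW'

lemma koszulEll_tensorial (Z : ∀ x : N, TangentSpace (𝓡 m) x) (x : N) :
    TensorialAt (𝓡 m) (EuclideanSpace ℝ (Fin m)) (fun X ↦ D.koszulEll X Z x) x where
  smul hf hX := D.koszulEll_smul_left hf hX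
  add hX hX' := D.koszulEll_add_left hX hX'

/-- The bilinear form `(X, W) ↦ koszul X Z W` at a point where `Z` is differentiable. -/
def koszulForm (Z : ∀ x : N, TangentSpace (𝓡 m) x) {x : N} (hZ : DiffFieldAt Z x) :
    TangentSpace (𝓡 m) x →L[ℝ] TangentSpace (𝓡 m) x →L[ℝ] ℝ :=
  TensorialAt.mkHom₂ (I := 𝓡 m) (F := EuclideanSpace ℝ (Fin m)) (F' := EuclideanSpace ℝ (Fin m))
    (fun X W ↦ D.koszul X Z W x) x (D.koszul_tensorial_left hZ) (D.koszul_tensorial_right hZ)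

/-- The linear form `X ↦ koszulEll X Z` at a point. -/
def koszulEllForm (Z : ∀ x : N, TangentSpace (𝓡 m) x) (x : N) : TangentSpace (𝓡 m) x →L[ℝ] ℝ :=
  TensorialAt.mkHom (I := 𝓡 m) (F := EuclideanSpace ℝ (Fin m)) _ x (D.koszulEll_tensorial Z x)

lemma koszulForm_apply (hX : DiffFieldAt X x) (hZ : DiffFieldAt Z x) (hW : DiffFieldAt W x) :
    D.koszulForm Z hZ (X x) (W x) = D.koszul X Z W x :=
  TensorialAt.mkHom₂_apply _ _ hX hW

lemma koszulEllForm_apply (hX : DiffFieldAt X x) :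
    D.koszulEllForm Z x (X x) = D.koszulEll X Z x :=
  TensorialAt.mkHom_apply _ hX

/-! ### The connection as solution of a linear system for `𝒜` -/

/-- The solution `(v, c) ∈ T_xN × ℝ` of `𝒜((v, c), (W, b)) = ½ koszul X Z W + ½ b koszulEll X Z`,
as a linear function of `X`. -/
def koszulSolution (Z : ∀ x : N, TangentSpace (𝓡 m) x) {x : N} (hZ : DiffFieldAt Z x) :
    TangentSpace (𝓡 m) x →ₗ[ℝ] TangentSpace (𝓡 m) x × ℝ where
  toFun u := ((ambientForm (D.γ x) (D.ell x) (D.ell₂ x)).toDual (D.nondegenerate x)).symm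
    (dualPair ((1 / 2 : ℝ) • D.koszulForm Z hZ u).toLinearMap
      ((1 / 2 : ℝ) * D.koszulEllForm Z x u))
  map_add' u v := by
    rw [← map_add]
    congr 1
    ext <;> simp [dualPair, mul_add]
  map_smul' c u := by
    rw [RingHom.id_apply, ← LinearEquiv.map_smul]
    congr 1
    ext <;> simp [dualPair, mul_left_comm]

open scoped Classical in
/-- The metric hypersurface connection, as an operation on vector fields. -/
def nablaFun (Z : ∀ x : N, TangentSpace (𝓡 m) x) (x : N) :
    TangentSpace (𝓡 m) x →L[ℝ] TangentSpace (𝓡 m) x :=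
  haveI : T2Space (TangentSpace (𝓡 m) x) := inferInstanceAs (T2Space (EuclideanSpace ℝ (Fin m)))
  -- The value 0 elsewhere is arbitrary: the axioms of a covariant derivative constrain only
  -- sections differentiable at the point.
  if hZ : DiffFieldAt Z x then
    LinearMap.toContinuousLinearMap (LinearMap.fst ℝ _ ℝ ∘ₗ D.koszulSolution Z hZ)
  else 0

lemma diffFieldAt_extend (v : TangentSpace (𝓡 m) x) :
    DiffFieldAt (FiberBundle.extend (EuclideanSpace ℝ (Fin m)) v) x :=
  FiberBundle.mdifferentiableAt_extend ..

/-- Nondegeneracy of `𝒜`, tested on fields instead of vectors, since every vector is the value at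
`x` of a field differentiable there. -/
lemma eq_of_ambientForm {v v' : TangentSpace (𝓡 m) x} {c c' : ℝ}
    (h₁ : ∀ W : ∀ x : N, TangentSpace (𝓡 m) x, DiffFieldAt W x →
      D.γ x v (W x) + c * D.ell x (W x) = D.γ x v' (W x) + c' * D.ell x (W x))
    (h₂ : D.ell x v + c * D.ell₂ x = D.ell x v' + c' * D.ell₂ x) : v = v' ∧ c = c' := by
  have h : (v - v', c - c') = 0 := by
    refine (D.nondegenerate x).1 _ fun ⟨w, b⟩ ↦ ?_
    have := h₁ _ (diffFieldAt_extend w)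
    simp only [FiberBundle.extend_apply_self] at this
    simp only [ambientForm, LinearMap.mk₂_apply, map_sub, sub_apply]
    linear_combination this + b * h₂
  rw [Prod.mk_eq_zero] at h
  exact ⟨sub_eq_zero.1 h.1, sub_eq_zero.1 h.2⟩

lemma koszulSolution_spec (hX : DiffFieldAt X x) (hZ : DiffFieldAt Z x) :
    ∃ c : ℝ, (∀ W : ∀ x : N, TangentSpace (𝓡 m) x, DiffFieldAt W x →
      D.γ x (D.nablaFun Z x (X x)) (W x) + c * D.ell x (W x) = 1 / 2 * D.koszul X Z W x) ∧
      D.ell x (D.nablaFun Z x (X x)) + c * D.ell₂ x = 1 / 2 * D.koszulEll X Z x := by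
  have e : D.nablaFun Z x (X x) = (D.koszulSolution Z hZ (X x)).1 := by simp [nablaFun, hZ]
  have h := fun p ↦ LinearMap.BilinForm.apply_toDual_symm_apply (hB := D.nondegenerate x)
    (f := dualPair ((1 / 2 : ℝ) • D.koszulForm Z hZ (X x)).toLinearMap
      ((1 / 2 : ℝ) * D.koszulEllForm Z x (X x))) (v := p)
  change ∀ p, ambientForm (D.γ x) (D.ell x) (D.ell₂ x) (D.koszulSolution Z hZ (X x)) p = _ at h
  rw [e]
  refine ⟨(D.koszulSolution Z hZ (X x)).2, fun W hW ↦ ?_, ?_⟩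
  · simpa [ambientForm, dualPair, D.koszulForm_apply hX hZ hW] using h (W x, 0)
  · simpa [ambientForm, dualPair, D.koszulEllForm_apply hX] using h (0, 1)

/-! ### The auxiliary scalar equals `-U` -/

lemma diffFieldAt_n (x : N) : DiffFieldAt D.n x :=
  (D.smooth_n_n₂ x).1.mdifferentiableAt (by simp)

lemma mdifferentiableAt_n₂ (x : N) : MDifferentiableAt (𝓡 m) 𝓘(ℝ, ℝ) D.n₂ x :=
  (D.smooth_n_n₂ x).2.mdifferentiableAt (by simp)

lemma gam_n_right (X : ∀ x : N, TangentSpace (𝓡 m) x) :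
    D.gam X D.n = -(D.n₂ * D.ellField X) := by
  ext y
  have := D.γ_n y (X y)
  simp only [gam, ellField, Pi.neg_apply, Pi.mul_apply, D.γ_symm y (X y)]
  linarith

/-- This identity is what dictates the form of `U`. Substituting `γ(·,n) = -n⁽²⁾ ℓ` and
differentiating, the terms carrying an undifferentiated `n⁽²⁾` cancel against `n⁽²⁾ k(X,Z)`. What is
left is `-£_n γ` and the products of `ℓ` with `dn⁽²⁾`. -/
lemma koszul_n (hX : DiffFieldAt X x) (hZ : DiffFieldAt Z x) :
    D.koszul X Z D.n x + D.n₂ x * D.koszulEll X Z x = -2 * D.U X Z x := by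
  have hn := D.γ_n x (VectorField.mlieBracket (𝓡 m) X Z x)
  rw [D.γ_symm] at hn
  simp only [koszul, koszulEll, U, lieGamma, gam_n_right, mvfderiv_neg,
    mvfderiv_mul (D.mdifferentiableAt_n₂ x) (D.mdifferentiableAt_ellField hX),
    mvfderiv_mul (D.mdifferentiableAt_n₂ x) (D.mdifferentiableAt_ellField hZ),
    VectorField.mlieBracket_swap_apply (V := X) (W := D.n),
    VectorField.mlieBracket_swap_apply (V := Z) (W := D.n),
    map_neg, neg_apply, add_apply, smul_apply, smul_eq_mul,
    D.γ_symm x (X x) (VectorField.mlieBracket (𝓡 m) D.n Z x)]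
  simp only [ellField]
  linear_combination hn

lemma U_comm (X Z : ∀ x : N, TangentSpace (𝓡 m) x) (x : N) : D.U X Z x = D.U Z X x := by
  simp only [U, lieGamma, D.gam_comm X Z, D.γ_symm x (X x), D.γ_symm x _ (Z x)]
  ring

lemma γ_n_right (v : TangentSpace (𝓡 m) x) : D.γ x v (D.n x) = -(D.n₂ x * D.ell x v) := by
  rw [D.γ_symm]; linarith [D.γ_n x v]

/-- The Koszul formulas that characterize the metric hypersurface connection. -/
lemma nablaFun_spec (hX : DiffFieldAt X x) (hZ : DiffFieldAt Z x) :
    (∀ W : ∀ x : N, TangentSpace (𝓡 m) x, DiffFieldAt W x →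
      D.γ x (D.nablaFun Z x (X x)) (W x) =
        1 / 2 * D.koszul X Z W x + D.U X Z x * D.ell x (W x)) ∧
      D.ell x (D.nablaFun Z x (X x)) =
        1 / 2 * D.koszulEll X Z x + D.U X Z x * D.ell₂ x := by
  obtain ⟨c, h₁, h₂⟩ := D.koszulSolution_spec hX hZ
  have h₃ := h₁ _ (D.diffFieldAt_n x)
  rw [γ_n_right] at h₃
  -- Pair `(v, c)` with `(n, n⁽²⁾)`: the terms in `v` cancel because `γ(v,n) = -n⁽²⁾ ℓ(v)`, and `c`
  -- is multiplied by `ℓ(n) + n⁽²⁾ ℓ⁽²⁾ = 1`.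
  have hc : c = -D.U X Z x := by
    linear_combination h₃ + D.n₂ x * h₂ - c * D.ell_n x + 1 / 2 * D.koszul_n hX hZ
  subst hc
  exact ⟨fun W hW ↦ by linear_combination h₁ W hW, by linear_combination h₂⟩

/-- The scalar `c` is left free, as nondegeneracy fixes it together with `v`. Candidates can thus be
checked without computing how `U` behaves under sums and multiples of `Z`. -/
lemma eq_nablaFun (hX : DiffFieldAt X x) (hZ : DiffFieldAt Z x) {v : TangentSpace (𝓡 m) x} {c : ℝ}
    (h₁ : ∀ W : ∀ x : N, TangentSpace (𝓡 m) x, DiffFieldAt W x →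
      D.γ x v (W x) = 1 / 2 * D.koszul X Z W x + c * D.ell x (W x))
    (h₂ : D.ell x v = 1 / 2 * D.koszulEll X Z x + c * D.ell₂ x) :
    v = D.nablaFun Z x (X x) := by
  obtain ⟨h₃, h₄⟩ := D.nablaFun_spec hX hZ
  refine (D.eq_of_ambientForm (c := -c) (c' := -D.U X Z x) (fun W hW ↦ ?_) ?_).1
  · rw [h₁ W hW, h₃ W hW]; ring
  · rw [h₂, h₄]; ring

/-! ### Connection axioms, torsion and the defining equations -/

lemma diffFieldAt_add (hX : DiffFieldAt X x) (hX' : DiffFieldAt X' x) : DiffFieldAt (X + X') x :=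
  mdifferentiableAt_add_section hX hX'

lemma diffFieldAt_smul (hf : MDifferentiableAt (𝓡 m) 𝓘(ℝ, ℝ) f x) (hX : DiffFieldAt X x) :
    DiffFieldAt (f • X) x :=
  hf.smul_section hX

lemma nablaFun_add (hZ : DiffFieldAt Z x) (hZ' : DiffFieldAt Z' x) :
    D.nablaFun (Z + Z') x = D.nablaFun Z x + D.nablaFun Z' x := by
  ext1 v
  have hX := diffFieldAt_extend v
  have h := D.nablaFun_spec hX hZ
  have h' := D.nablaFun_spec hX hZ'
  have := D.eq_nablaFun hX (diffFieldAt_add hZ hZ')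
    (v := D.nablaFun Z x (FiberBundle.extend (EuclideanSpace ℝ (Fin m)) v x) +
      D.nablaFun Z' x (FiberBundle.extend (EuclideanSpace ℝ (Fin m)) v x))
    (c := D.U (FiberBundle.extend (EuclideanSpace ℝ (Fin m)) v) Z x +
      D.U (FiberBundle.extend (EuclideanSpace ℝ (Fin m)) v) Z' x)
    (fun W hW ↦ by
      rw [map_add, add_apply, h.1 W hW, h'.1 W hW, D.koszul_add_middle hX hZ hZ' hW]; ring)
    (by rw [map_add, h.2, h'.2, D.koszulEll_add_right hZ hZ']; ring)
  simpa using this.symm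

lemma nablaFun_smul (hf : MDifferentiableAt (𝓡 m) 𝓘(ℝ, ℝ) f x) (hZ : DiffFieldAt Z x) :
    D.nablaFun (f • Z) x =
      f x • D.nablaFun Z x + (mvfderiv (𝓡 m) f x).smulRight (Z x) := by
  ext1 v
  set X := FiberBundle.extend (EuclideanSpace ℝ (Fin m)) v with hXdef
  have hX : DiffFieldAt X x := diffFieldAt_extend v
  have h := D.nablaFun_spec hX hZ
  have := D.eq_nablaFun hX (diffFieldAt_smul hf hZ)
    (v := f x • D.nablaFun Z x (X x) + mvfderiv (𝓡 m) f x (X x) • Z x)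
    (c := f x * D.U X Z x)
    (fun W hW ↦ by
      rw [map_add, map_smul, map_smul, add_apply, smul_apply, smul_apply, h.1 W hW,
        D.koszul_smul_middle hf hX hZ hW]
      simp only [smul_eq_mul]
      ring)
    (by
      rw [map_add, map_smul, map_smul, h.2, D.koszulEll_smul_right hf hZ]
      simp only [smul_eq_mul]
      ring)
  simpa [hXdef] using this.symm

/-- The metric hypersurface connection. -/
def hypersurfaceConnection : CovariantDerivative (𝓡 m) (EuclideanSpace ℝ (Fin m))
    (TangentSpace (𝓡 m) : N → Type _) where
  toFun := D.nablaFun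
  isCovariantDerivativeOnUniv :=
    { add := fun hZ hZ' _ ↦ D.nablaFun_add hZ hZ'
      leibniz := fun hZ hf _ ↦ D.nablaFun_smul hf hZ }

/-- The part of `K` antisymmetric in `X, Z` is the bracket term. Since `U` is symmetric, this is the
`γ`-component of vanishing torsion. -/
lemma koszul_sub_swap (X Z W : ∀ x : N, TangentSpace (𝓡 m) x) (x : N) :
    D.koszul X Z W x - D.koszul Z X W x =
      2 * D.γ x (VectorField.mlieBracket (𝓡 m) X Z x) (W x) := by
  simp only [koszul, D.gam_comm Z X, VectorField.mlieBracket_swap_apply (V := Z) (W := X),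
    map_neg, neg_apply]
  ring

lemma hypersurfaceConnection_torsion : D.hypersurfaceConnection.torsion = 0 := by
  rw [CovariantDerivative.torsion_eq_zero_iff]
  intro X Z x hX hZ
  have h := D.nablaFun_spec hX hZ
  have h' := D.nablaFun_spec hZ hX
  change D.nablaFun Z x (X x) - D.nablaFun X x (Z x) = _
  refine (D.eq_of_ambientForm (c := 0) (c' := 0) (fun W hW ↦ ?_) ?_).1
  · rw [map_sub, sub_apply, h.1 W hW, h'.1 W hW, D.U_comm Z X]
    linear_combination 1 / 2 * D.koszul_sub_swap X Z W x
  · rw [map_sub, h.2, h'.2, D.U_comm Z X]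
    simp only [koszulEll, VectorField.mlieBracket_swap_apply (V := Z) (W := X), map_neg]
    ring

/-- Symmetrizing `K` in its last two slots cancels all brackets. This is compatibility with `γ`, up
to the correction in `U`. -/
lemma koszul_add_swap (X Z W : ∀ x : N, TangentSpace (𝓡 m) x) (x : N) :
    D.koszul X Z W x + D.koszul X W Z x = 2 * mvfderiv (𝓡 m) (D.gam Z W) x (X x) := by
  simp only [koszul, D.gam_comm W Z, VectorField.mlieBracket_swap_apply (V := W) (W := Z),
    map_neg, neg_apply]
  ring

lemma hypersurfaceConnection_covGamma (hX : DiffFieldAt X x) (hZ : DiffFieldAt Z x)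
    (hW : DiffFieldAt W x) :
    D.covGamma D.hypersurfaceConnection X Z W x =
      - D.U X Z x * D.ell x (W x) - D.U X W x * D.ell x (Z x) := by
  have h := (D.nablaFun_spec hX hZ).1 W hW
  have h' := (D.nablaFun_spec hX hW).1 Z hZ
  rw [covGamma, D.γ_symm x (Z x)]
  change _ - D.γ x (D.nablaFun Z x (X x)) (W x) - D.γ x (D.nablaFun W x (X x)) (Z x) = _
  linear_combination -h - h' - 1 / 2 * D.koszul_add_swap X Z W x

lemma hypersurfaceConnection_covEll (hX : DiffFieldAt X x) (hZ : DiffFieldAt Z x) :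
    D.covEll D.hypersurfaceConnection X Z x + D.covEll D.hypersurfaceConnection Z X x =
      - 2 * D.ell₂ x * D.U X Z x := by
  have h := (D.nablaFun_spec hX hZ).2
  have h' := (D.nablaFun_spec hZ hX).2
  simp only [covEll]
  change _ - D.ell x (D.nablaFun Z x (X x)) + (_ - D.ell x (D.nablaFun X x (Z x))) = _
  rw [h, h', D.U_comm Z X]
  simp only [koszulEll, VectorField.mlieBracket_swap_apply (V := Z) (W := X), map_neg,
    show (fun y ↦ D.ell y (X y)) = D.ellField X from rfl,
    show (fun y ↦ D.ell y (Z y)) = D.ellField Z from rfl]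
  ring

end MetricHypersurfaceData

/-! ### Smoothness of the connection -/

section HomBundle

variable {m : ℕ} {N : Type*} [TopologicalSpace N]
  [ChartedSpace (EuclideanSpace ℝ (Fin m)) N] [IsManifold (𝓡 m) ∞ N]

/-- A field of linear maps is smooth at a point as soon as its values on smooth vector fields are. -/
lemma contMDiffAt_endomorphism_of_apply {x : N}
    {φ : ∀ x : N, TangentSpace (𝓡 m) x →L[ℝ] TangentSpace (𝓡 m) x}
    (h : ∀ X : ∀ x : N, TangentSpace (𝓡 m) x, SmoothFieldAt X x →
      SmoothFieldAt (fun y ↦ φ y (X y)) x) :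
    ContMDiffAt (𝓡 m)
      ((𝓡 m).prod 𝓘(ℝ, EuclideanSpace ℝ (Fin m) →L[ℝ] EuclideanSpace ℝ (Fin m))) ∞
      (fun y ↦ TotalSpace.mk' (EuclideanSpace ℝ (Fin m) →L[ℝ] EuclideanSpace ℝ (Fin m))
        (E := fun y : N ↦ TangentSpace (𝓡 m) y →L[ℝ] TangentSpace (𝓡 m) y) y (φ y)) x := by
  rw [contMDiffAt_hom_bundle]
  refine ⟨contMDiffAt_id, ?_⟩
  set t := trivializationAt (EuclideanSpace ℝ (Fin m)) (TangentSpace (𝓡 m) : N → Type _) x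
  have hx : x ∈ t.baseSet := FiberBundle.mem_baseSet_trivializationAt' x
  set b := (EuclideanSpace.basisFun (Fin m) ℝ).toBasis
  have hs : ∀ i, SmoothFieldAt (t.localFrame b i) x :=
    fun i ↦ contMDiffAt_localFrame_of_mem ∞ t b i hx
  have hc : ∀ i, ContMDiffAt (𝓡 m) 𝓘(ℝ, EuclideanSpace ℝ (Fin m)) ∞
      (fun y ↦ (t ⟨y, φ y (t.localFrame b i y)⟩).2) x :=
    fun i ↦ (t.contMDiffAt_section_iff hx).1 (h _ (hs i))
  -- In the trivialization, a linear map is the sum of the coordinate functionals times the images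
  -- of the frame vectors.
  have hsum : ContMDiffAt (𝓡 m) 𝓘(ℝ, EuclideanSpace ℝ (Fin m) →L[ℝ] EuclideanSpace ℝ (Fin m)) ∞
      (fun y ↦ ∑ i, ContinuousLinearMap.smulRightL ℝ (EuclideanSpace ℝ (Fin m))
        (EuclideanSpace ℝ (Fin m)) (EuclideanSpace.proj i)
        (t ⟨y, φ y (t.localFrame b i y)⟩).2) x :=
    contMDiffAt_finsetSum fun i _ ↦
      (ContinuousLinearMap.contMDiff _).contMDiffAt.comp x (hc i)
  refine hsum.congr_of_eventuallyEq ?_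
  filter_upwards [t.open_baseSet.mem_nhds hx] with y hy
  refine ContinuousLinearMap.coe_injective (b.ext fun i ↦ ?_)
  have hb : t.symmL ℝ y (b i) = t.localFrame b i y := by
    rw [Trivialization.symmL_apply]
    · simp [hy, Trivialization.basisAt]
    · exact hy
  have hy' : t.continuousLinearMapAt ℝ y (φ y (t.symmL ℝ y (b i))) =
      (t ⟨y, φ y (t.localFrame b i y)⟩).2 := by
    rw [hb, Trivialization.continuousLinearMapAt_apply, t.linearMapAt_apply, if_pos hy]
  have hbi : ∀ j, b i j = if j = i then 1 else 0 := by
    intro j; simp [b]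
  refine hy'.trans ?_
  simp [hbi]

lemma SmoothFieldAt.eventually_diffFieldAt {X : ∀ x : N, TangentSpace (𝓡 m) x} {x : N}
    (hX : SmoothFieldAt X x) : ∀ᶠ y in 𝓝 x, DiffFieldAt X y :=
  -- Order `∞` at a point gives each finite order on some neighbourhood, which may depend on the
  -- order; order one suffices here.
  (contMDiffAt_iff_contMDiffAt_nhds (by simp) |>.1 (ContMDiffAt.of_le hX (m := 1) (by simp))).mono
    fun _ hy ↦ hy.mdifferentiableAt one_ne_zero

end HomBundle

namespace MetricHypersurfaceData

variable {m : ℕ} {N : Type*} [TopologicalSpace N]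
  [ChartedSpace (EuclideanSpace ℝ (Fin m)) N] [IsManifold (𝓡 m) ∞ N]
  (D : MetricHypersurfaceData m N) {X Z : ∀ x : N, TangentSpace (𝓡 m) x} {x : N}

lemma contMDiffAt_koszul (hX : SmoothFieldAt X x) (hZ : SmoothFieldAt Z x)
    (hW : SmoothFieldAt W x) :
    ContMDiffAt (𝓡 m) 𝓘(ℝ, ℝ) ∞ (D.koszul X Z W) x :=
  ((((((D.contMDiffAt_gam hZ hW).mvfderiv_apply hX).add
    ((D.contMDiffAt_gam hX hW).mvfderiv_apply hZ)).sub
    ((D.contMDiffAt_gam hX hZ).mvfderiv_apply hW)).add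
    (D.contMDiffAt_gam (ContMDiffAt.mlieBracket_smooth hX hZ) hW)).sub
    (D.contMDiffAt_gam (ContMDiffAt.mlieBracket_smooth hX hW) hZ)).sub
    (D.contMDiffAt_gam (ContMDiffAt.mlieBracket_smooth hZ hW) hX)

lemma contMDiffAt_koszulEll (hX : SmoothFieldAt X x) (hZ : SmoothFieldAt Z x) :
    ContMDiffAt (𝓡 m) 𝓘(ℝ, ℝ) ∞ (D.koszulEll X Z) x :=
  (((D.contMDiffAt_ell hZ).mvfderiv_apply hX).add
    ((D.contMDiffAt_ell hX).mvfderiv_apply hZ)).add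
    (D.contMDiffAt_ell (ContMDiffAt.mlieBracket_smooth hX hZ))

/-- The contractions of `(∇_X Z, -U(X,Z))` with `𝒜` are half the Koszul expressions, which are
smooth for smooth fields. -/
lemma smoothFieldAt_nablaFun (hX : SmoothFieldAt X x) (hZ : SmoothFieldAt Z x) :
    SmoothFieldAt (fun y ↦ D.nablaFun Z y (X y)) x := by
  refine (D.smooth_of_ambientForm (a := fun y ↦ -D.U X Z y) (fun W hW ↦ ?_) ?_).1
  · refine ((contMDiffAt_const (c := (1 / 2 : ℝ))).mul
      (D.contMDiffAt_koszul hX hZ hW)).congr_of_eventuallyEq ?_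
    filter_upwards [hX.eventually_diffFieldAt, hZ.eventually_diffFieldAt,
      hW.eventually_diffFieldAt] with y hX hZ hW
    rw [(D.nablaFun_spec hX hZ).1 W hW]
    simp
  · refine ((contMDiffAt_const (c := (1 / 2 : ℝ))).mul
      (D.contMDiffAt_koszulEll hX hZ)).congr_of_eventuallyEq ?_
    filter_upwards [hX.eventually_diffFieldAt, hZ.eventually_diffFieldAt] with y hX hZ
    rw [(D.nablaFun_spec hX hZ).2]
    simp

lemma hypersurfaceConnection_smooth :
    D.hypersurfaceConnection.ContMDiffCovariantDerivative ∞ where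
  contMDiff :=
    { contMDiff := fun {σ} hσ x _ ↦ by
        have hσ' : SmoothFieldAt σ x := (hσ.contMDiffAt univ_mem).of_le (by simp)
        exact (contMDiffAt_endomorphism_of_apply
          fun X hX ↦ D.smoothFieldAt_nablaFun hX hσ').contMDiffWithinAt }

lemma isMetricHypersurfaceConnection_hypersurfaceConnection :
    D.IsMetricHypersurfaceConnection D.hypersurfaceConnection where
  smooth := D.hypersurfaceConnection_smooth
  torsion_free := D.hypersurfaceConnection_torsion
  cov_gamma X Z W x := D.hypersurfaceConnection_covGamma (X.contMDiff.mdifferentiable (by simp) x)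
    (Z.contMDiff.mdifferentiable (by simp) x) (W.contMDiff.mdifferentiable (by simp) x)
  cov_ell X Z x := D.hypersurfaceConnection_covEll (X.contMDiff.mdifferentiable (by simp) x)
    (Z.contMDiff.mdifferentiable (by simp) x)

/-! ### Uniqueness -/

variable {D} in
lemma IsMetricHypersurfaceConnection.eq_nablaFun [T2Space N]
    {nabla : CovariantDerivative (𝓡 m) (EuclideanSpace ℝ (Fin m))
      (TangentSpace (𝓡 m) : N → Type _)} (h : D.IsMetricHypersurfaceConnection nabla)
    (X Z : Cₛ^∞⟮𝓡 m; EuclideanSpace ℝ (Fin m), (TangentSpace (𝓡 m) : N → Type _)⟯) (x : N) :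
    nabla Z x (X x) = D.nablaFun Z x (X x) := by
  have hd : ∀ Y : Cₛ^∞⟮𝓡 m; EuclideanSpace ℝ (Fin m), (TangentSpace (𝓡 m) : N → Type _)⟯,
      DiffFieldAt Y x := fun Y ↦ Y.contMDiff.mdifferentiable (by simp) x
  have ht : ∀ X Y : Cₛ^∞⟮𝓡 m; EuclideanSpace ℝ (Fin m), (TangentSpace (𝓡 m) : N → Type _)⟯,
      nabla Y x (X x) - nabla X x (Y x) = VectorField.mlieBracket (𝓡 m) X Y x :=
    fun X Y ↦ (nabla.torsion_eq_zero_iff.1 h.torsion_free) (hd X) (hd Y)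
  refine D.eq_nablaFun (c := D.U X Z x) (hd X) (hd Z) (fun W hW ↦ ?_) ?_
  -- The equation for `∇γ` is assumed only for smooth fields. Since `K` is tensorial in `W`, a
  -- global smooth field with the same value at `x` may replace `W`.
  · obtain ⟨W', hW'⟩ := exists_smooth_extension x (W x)
    have hk : D.koszul X Z W x = D.koszul X Z W' x :=
      (D.koszul_tensorial_right (hd Z) X (hd X)).pointwise hW (hd W') hW'.symm
    rw [hk, ← hW']
    have h₁ := h.cov_gamma X Z W' x
    have h₂ := h.cov_gamma Z X W' x
    have h₃ := h.cov_gamma W' X Z x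
    simp only [covGamma, D.U_comm W' _, D.U_comm Z X] at h₁ h₂ h₃
    simp only [koszul, ← ht, map_sub, sub_apply, D.γ_symm x _ (X x)] at *
    simp only [D.γ_symm x _ (Z x)] at *
    -- In the sum of the first two equations minus the third, all products of `U` and `ℓ` cancel
    -- except `-2 U(X,Z) ℓ(W)`.
    linear_combination -1 / 2 * h₁ - 1 / 2 * h₂ + 1 / 2 * h₃
  · have h₁ := h.cov_ell X Z x
    simp only [covEll] at h₁
    simp only [koszulEll, ← ht, map_sub]
    simp only [show D.ellField X = fun y ↦ D.ell y (X y) from rfl,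
      show D.ellField Z = fun y ↦ D.ell y (Z y) from rfl]
    linear_combination -1 / 2 * h₁

variable {D} in
-- The difference of two connections is tensorial in the differentiated field, so a merely
-- differentiable `Z` may be replaced by a smooth field with the same value at `x`.
lemma IsMetricHypersurfaceConnection.eq_hypersurfaceConnection [T2Space N]
    {nabla : CovariantDerivative (𝓡 m) (EuclideanSpace ℝ (Fin m))
      (TangentSpace (𝓡 m) : N → Type _)} (h : D.IsMetricHypersurfaceConnection nabla)
    (hZ : DiffFieldAt Z x) : nabla Z x = D.hypersurfaceConnection Z x := by
  obtain ⟨Z', hZ'⟩ := exists_smooth_extension x (Z x)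
  have hd : DiffFieldAt Z' x := Z'.contMDiff.mdifferentiable (by simp) x
  have e₁ := IsCovariantDerivativeOn.difference_apply nabla.isCovariantDerivativeOnUniv
    D.hypersurfaceConnection.isCovariantDerivativeOnUniv (hx := Set.mem_univ x) hZ
  have e₂ := IsCovariantDerivativeOn.difference_apply nabla.isCovariantDerivativeOnUniv
    D.hypersurfaceConnection.isCovariantDerivativeOnUniv (hx := Set.mem_univ x) hd
  rw [hZ', e₁] at e₂
  rw [← sub_eq_zero, e₂, sub_eq_zero]
  ext1 v
  obtain ⟨X, rfl⟩ := exists_smooth_extension x v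
  exact h.eq_nablaFun X Z' x

end MetricHypersurfaceData

lemma mlieBracket_const {E : Type*} [NormedAddCommGroup E] [NormedSpace ℝ E] (v w x : E) :
    VectorField.mlieBracket 𝓘(ℝ, E) (fun _ ↦ v) (fun _ ↦ w) x = 0 := by
  have h : VectorField.lieBracketWithin ℝ (fun _ : E ↦ v) (fun _ ↦ w) Set.univ x = 0 := by
    simp [VectorField.lieBracketWithin]
  have h' := VectorField.mlieBracketWithin_eq_lieBracketWithin (𝕜 := ℝ) (E := E) (s := Set.univ)
    (V := fun _ ↦ v) (W := fun _ ↦ w)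
  exact (congrFun VectorField.mlieBracketWithin_univ.symm x).trans ((congrFun h' x).trans h)

/-! ### Coordinate fields and forms of a chart -/

section Coordinates

variable {m : ℕ} {N : Type*} [TopologicalSpace N]
  [ChartedSpace (EuclideanSpace ℝ (Fin m)) N]
  {e : OpenPartialHomeomorph N (EuclideanSpace ℝ (Fin m))} {x : N}

lemma mdifferentiable_of_mem_maximalAtlas (he : e ∈ IsManifold.maximalAtlas (𝓡 m) ∞ N) :
    e.MDifferentiable (𝓡 m) (𝓡 m) :=
  ⟨(contMDiffOn_of_mem_maximalAtlas he).mdifferentiableOn (by simp),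
    (contMDiffOn_symm_of_mem_maximalAtlas he).mdifferentiableOn (by simp)⟩

lemma isInvertible_mfderiv_of_mem_maximalAtlas (he : e ∈ IsManifold.maximalAtlas (𝓡 m) ∞ N)
    (hx : x ∈ e.source) : (mfderiv (𝓡 m) (𝓡 m) e x).IsInvertible :=
  ⟨(mdifferentiable_of_mem_maximalAtlas he).mfderiv hx, rfl⟩

lemma mfderiv_coordField (he : e ∈ IsManifold.maximalAtlas (𝓡 m) ∞ N) (hx : x ∈ e.source)
    (a : Fin m) :
    mfderiv (𝓡 m) (𝓡 m) e x (coordField e a x) = EuclideanSpace.single a (1 : ℝ) :=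
  (isInvertible_mfderiv_of_mem_maximalAtlas he hx).self_apply_inverse _

lemma coordForm_apply (he : e ∈ IsManifold.maximalAtlas (𝓡 m) ∞ N) (hx : x ∈ e.source)
    (c : Fin m) (v : TangentSpace (𝓡 m) x) :
    coordForm e c x v = (mfderiv (𝓡 m) (𝓡 m) e x v).ofLp c := by
  have hd := (mdifferentiable_of_mem_maximalAtlas he).mdifferentiableAt hx
  have hp : HasMFDerivAt (𝓡 m) 𝓘(ℝ, ℝ) (fun z : EuclideanSpace ℝ (Fin m) ↦ z c) (e x)
      (EuclideanSpace.proj c : EuclideanSpace ℝ (Fin m) →L[ℝ] ℝ) :=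
    (EuclideanSpace.proj c : EuclideanSpace ℝ (Fin m) →L[ℝ] ℝ).hasMFDerivAt
  have h := (hp.comp x hd.hasMFDerivAt).mfderiv
  exact congrArg (fun L : TangentSpace (𝓡 m) x →L[ℝ] ℝ ↦ L v) h

lemma sum_coordForm_smul_coordField (he : e ∈ IsManifold.maximalAtlas (𝓡 m) ∞ N)
    (hx : x ∈ e.source) (v : TangentSpace (𝓡 m) x) :
    ∑ c, coordForm e c x v • coordField e c x = v := by
  apply (mdifferentiable_of_mem_maximalAtlas he).mfderiv_injective hx
  rw [map_sum]
  simp only [map_smul, mfderiv_coordField he hx, coordForm_apply he hx]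
  simpa using! (EuclideanSpace.basisFun (Fin m) ℝ).sum_repr (mfderiv (𝓡 m) (𝓡 m) e x v)

lemma mvfderiv_coordField (he : e ∈ IsManifold.maximalAtlas (𝓡 m) ∞ N) (hx : x ∈ e.source)
    (a : Fin m) {f : N → ℝ} (hf : MDifferentiableAt (𝓡 m) 𝓘(ℝ, ℝ) f x) :
    mvfderiv (𝓡 m) f x (coordField e a x) = coordPartial e a f x := by
  have hd := mdifferentiable_of_mem_maximalAtlas he
  have hg : MDifferentiableAt (𝓡 m) 𝓘(ℝ, ℝ) (f ∘ e.symm) (e x) :=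
    MDifferentiableAt.comp (e x) (by rwa [e.left_inv hx])
      (hd.mdifferentiableAt_symm (e.map_source hx))
  have hfe : f =ᶠ[𝓝 x] (f ∘ e.symm) ∘ e := by
    filter_upwards [e.open_source.mem_nhds hx] with y hy
    simp [e.left_inv hy]
  have h : mvfderiv (𝓡 m) f x (coordField e a x) =
      mvfderiv (𝓡 m) ((f ∘ e.symm) ∘ e) x (coordField e a x) := by
    have := hfe.mfderiv_eq (I := 𝓡 m) (I' := 𝓘(ℝ, ℝ))
    exact congrArg (fun L : TangentSpace (𝓡 m) x →L[ℝ] ℝ ↦ L (coordField e a x)) this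
  rw [h, mvfderiv_comp_apply x hg (hd.mdifferentiableAt hx), mfderiv_coordField he hx,
    coordPartial, ← mfderiv_eq_fderiv]
  rfl

variable [IsManifold (𝓡 m) ∞ N]

lemma smoothFieldAt_coordField (he : e ∈ IsManifold.maximalAtlas (𝓡 m) ∞ N) (hx : x ∈ e.source)
    (a : Fin m) : SmoothFieldAt (coordField e a) x := by
  refine ContMDiffAt.mpullback_vectorField_preimage (n := ∞) (m := ∞) ?_
    (contMDiffAt_of_mem_maximalAtlas he hx)
    (isInvertible_mfderiv_of_mem_maximalAtlas he hx) (by simp)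
  exact (contMDiffAt_vectorSpace_iff_contDiffAt
    (V := fun _ ↦ EuclideanSpace.single a (1 : ℝ))).2 contDiffAt_const

lemma diffFieldAt_coordField (he : e ∈ IsManifold.maximalAtlas (𝓡 m) ∞ N) (hx : x ∈ e.source)
    (a : Fin m) : DiffFieldAt (coordField e a) x :=
  (smoothFieldAt_coordField he hx a).mdifferentiableAt (by simp)

/-- Pullback commutes with the bracket, and constant fields on the model space commute. -/
lemma mlieBracket_coordField (he : e ∈ IsManifold.maximalAtlas (𝓡 m) ∞ N) (hx : x ∈ e.source)
    (a b : Fin m) :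
    VectorField.mlieBracket (𝓡 m) (coordField e a) (coordField e b) x = 0 := by
  have hc : ∀ a : Fin m, MDifferentiableAt 𝓘(ℝ, EuclideanSpace ℝ (Fin m))
      𝓘(ℝ, EuclideanSpace ℝ (Fin m)).tangent
      (fun y ↦ (⟨y, EuclideanSpace.single a (1 : ℝ)⟩ :
        TangentBundle 𝓘(ℝ, EuclideanSpace ℝ (Fin m)) (EuclideanSpace ℝ (Fin m)))) (e x) :=
    fun a ↦ (contMDiffAt_vectorSpace_iff_contDiffAt (n := 1)
      (V := fun _ ↦ EuclideanSpace.single a (1 : ℝ)).2 contDiffAt_const).mdifferentiableAt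
        one_ne_zero
  have := VectorField.mpullback_mlieBracket (n := ∞) (hc a) (hc b)
    (contMDiffAt_of_mem_maximalAtlas he hx)
    (by rw [minSmoothness_of_isRCLikeNormedField]; norm_cast)
  exact this.symm.trans
    ((congrArg (mfderiv (𝓡 m) (𝓡 m) e x).inverse (mlieBracket_const _ _ _)).trans (map_zero _))

end Coordinates

namespace HypersurfaceAlgebra

lemma dualPair_zero_right {V : Type*} [AddCommGroup V] [Module ℝ V] (β : Module.Dual ℝ V) :
    dualPair β 0 = β ∘ₗ LinearMap.fst ℝ V ℝ := by
  simp [dualPair]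

end HypersurfaceAlgebra

/-! ### Christoffel symbols -/

namespace MetricHypersurfaceData

variable {m : ℕ} {N : Type*} [TopologicalSpace N]
  [ChartedSpace (EuclideanSpace ℝ (Fin m)) N] [IsManifold (𝓡 m) ∞ N]
  (D : MetricHypersurfaceData m N)
  {e : OpenPartialHomeomorph N (EuclideanSpace ℝ (Fin m))} {x : N}

/-- `P(α, ·)` as a linear form. -/
def PLeft (x : N) (α : Module.Dual ℝ (TangentSpace (𝓡 m) x)) :
    Module.Dual ℝ (TangentSpace (𝓡 m) x) →ₗ[ℝ] ℝ where
  toFun β := D.P x α β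
  map_add' β β' := by
    simp only [P, Asharp, sharpForm, dualPair_zero_right, LinearMap.add_comp, map_add]
  map_smul' c β := by
    simp only [P, Asharp, sharpForm, dualPair_zero_right, LinearMap.smul_comp,
      map_smul, RingHom.id_apply]

lemma koszul_coordField (he : e ∈ IsManifold.maximalAtlas (𝓡 m) ∞ N) (hx : x ∈ e.source)
    (a b d : Fin m) :
    D.koszul (coordField e b) (coordField e a) (coordField e d) x =
      coordPartial e a (D.γComp e b d) x + coordPartial e b (D.γComp e a d) x
        - coordPartial e d (D.γComp e a b) x := by
  have hd := diffFieldAt_coordField he hx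
  simp only [koszul, mlieBracket_coordField he hx,
    mvfderiv_coordField he hx _ (D.mdifferentiableAt_gam (hd _) (hd _)),
    D.gam_comm (coordField e b) (coordField e a), map_zero, zero_apply]
  simp only [show ∀ a b, D.gam (coordField e a) (coordField e b) = D.γComp e a b from
    fun _ _ ↦ rfl]
  ring

lemma koszulEll_coordField (he : e ∈ IsManifold.maximalAtlas (𝓡 m) ∞ N) (hx : x ∈ e.source)
    (a b : Fin m) :
    D.koszulEll (coordField e b) (coordField e a) x =
      coordPartial e a (D.ellComp e b) x + coordPartial e b (D.ellComp e a) x := by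
  have hd := diffFieldAt_coordField he hx
  simp only [koszulEll, mlieBracket_coordField he hx,
    mvfderiv_coordField he hx _ (D.mdifferentiableAt_ellField (hd _)), map_zero]
  simp only [show ∀ a, D.ellField (coordField e a) = D.ellComp e a from fun _ ↦ rfl]
  ring

/-- The Christoffel symbols of the metric hypersurface connection. -/
lemma coordForm_hypersurfaceConnection (he : e ∈ IsManifold.maximalAtlas (𝓡 m) ∞ N)
    (hx : x ∈ e.source) (a b c : Fin m) :
    coordForm e c x (D.hypersurfaceConnection (coordField e a) x (coordField e b x)) =
      D.christoffel e c a b x := by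
  have hd := diffFieldAt_coordField he hx
  obtain ⟨h₁, h₂⟩ := D.nablaFun_spec (hd b) (hd a)
  change coordForm e c x (D.nablaFun (coordField e a) x (coordField e b x)) = _
  set v := D.nablaFun (coordField e a) x (coordField e b x)
  set u := D.U (coordField e b) (coordField e a) x
  -- The first Koszul formula, expanded in the coordinate coframe so that `P(dx^c, ·)` can be
  -- applied term by term.
  have hγ : (D.γ x v).toLinearMap =
      (∑ d, (1 / 2 * D.koszul (coordField e b) (coordField e a) (coordField e d) x) •
        (coordForm e d x).toLinearMap) + u • (D.ell x).toLinearMap := by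
    ext w
    have hw := sum_coordForm_smul_coordField he hx w
    have e₁ : D.γ x v w = ∑ d, coordForm e d x w * D.γ x v (coordField e d x) := by
      conv_lhs => rw [← hw]
      simp
    have e₂ : D.ell x w = ∑ d, coordForm e d x w * D.ell x (coordField e d x) := by
      conv_lhs => rw [← hw]
      simp
    simp only [ContinuousLinearMap.coe_coe, LinearMap.add_apply, LinearMap.sum_apply,
      LinearMap.smul_apply, smul_eq_mul]
    rw [e₁, e₂, Finset.mul_sum, ← Finset.sum_add_distrib]
    refine Finset.sum_congr rfl fun d _ ↦ ?_
    rw [h₁ _ (hd d)]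
    ring
  have hP := D.P_γ x (coordForm e c x).toLinearMap v
  have hPl := D.P_ell x (coordForm e c x).toLinearMap
  change D.PLeft x _ _ + _ = _ at hP hPl
  rw [hγ, map_add, map_sum, h₂] at hP
  simp only [map_smul, smul_eq_mul, koszul_coordField D he hx, koszulEll_coordField D he hx,
    ContinuousLinearMap.coe_coe] at hP hPl
  rw [← hP, christoffel, nComp, Finset.mul_sum]
  have hs : ∀ d, D.PComp e c d x = D.PLeft x (coordForm e c x).toLinearMap
    (coordForm e d x).toLinearMap := fun _ ↦ rfl
  simp only [hs]
  simp only [fun p q : ℝ ↦ (by ring : 1 / 2 * (p * q) = 1 / 2 * q * p)]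
  -- The terms in `U` add up to `U (P(dx^c, ℓ) + ℓ⁽²⁾ n^c)`, which is zero; this is why `U` is
  -- absent from the Christoffel symbols.
  linear_combination u * hPl

end MetricHypersurfaceData

end

theorem mainTheorem3 {m : ℕ} {N : Type*} [TopologicalSpace N] [T2Space N]
    [ChartedSpace (EuclideanSpace ℝ (Fin m)) N] [IsManifold (𝓡 m) ∞ N]
    (D : MetricHypersurfaceData m N) :
    ∃ nabla : CovariantDerivative (𝓡 m) (EuclideanSpace ℝ (Fin m))
        (TangentSpace (𝓡 m) : N → Type _),
      D.IsMetricHypersurfaceConnection nabla ∧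
      (∀ nabla' : CovariantDerivative (𝓡 m) (EuclideanSpace ℝ (Fin m))
          (TangentSpace (𝓡 m) : N → Type _),
        D.IsMetricHypersurfaceConnection nabla' →
          ∀ (Z : ∀ x : N, TangentSpace (𝓡 m) x) (x : N),
            MDifferentiableAt (𝓡 m) ((𝓡 m).prod 𝓘(ℝ, EuclideanSpace ℝ (Fin m)))
              (fun y ↦ TotalSpace.mk' (EuclideanSpace ℝ (Fin m)) y (Z y)) x →
            nabla' Z x = nabla Z x) ∧
      (∀ e ∈ IsManifold.maximalAtlas (𝓡 m) ∞ N, ∀ x ∈ e.source, ∀ a b : Fin m,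
        nabla (coordField e a) x (coordField e b x) =
          ∑ c, D.christoffel e c a b x • coordField e c x) := by
  refine ⟨D.hypersurfaceConnection, D.isMetricHypersurfaceConnection_hypersurfaceConnection,
    fun nabla' h Z x hZ ↦ h.eq_hypersurfaceConnection hZ, fun e he x hx a b ↦ ?_⟩
  simp only [← D.coordForm_hypersurfaceConnection he hx]
  exact (sum_coordForm_smul_coordField he hx _).symm
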